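/- Write $\mathbb{M}_n$ for the $n\times n$ complex matrices and $\mathbb{M}_n^+$ for the positive semidefinite ones; a linear map between matrix algebras is called positive if it maps positive semidefinite matrices to positive semidefinite matrices. For $X\in\mathbb{M}_n^+$ let $\lambda(X)=(\lambda_1(X)\ge\dots\ge\lambda_n(X))$ be its eigenvalues and for $X\in\mathbb{M}_n$ let $s(X)=(s_1(X)\ge\dots\ge s_n(X))$ be its singular values, in decreasing order with multiplicities. Powers and products of nonnegative vectors are taken entrywise, with $0^0:=1$, and $A^0:=I_n$ for $A\in\mathbb{M}_n^+$. For decreasing vectors $a,b\in[0,\infty)^n$, $a\prec_{w(\log)}b$ means $\prod_{i=1}^k a_i\le\prod_{i=1}^k b_i$ for $1\le k\le n$, and $a\prec_{(\log)}b$ means in addition that equality holds for $k=n$. **Theorem 3.1.** Let $p_0,p_1\in[0,\infty)$, $0\le\alpha\le1$ and $p_\alpha:=(1-\alpha)p_0+\alpha p_1$. Let $\Phi:\mathbb{M}_n\to\mathbb{M}_l$ and $\Psi:\mathbb{M}_m\to\mathbb{M}_l$ be positive linear maps. Then for every $A\in\mathbb{M}_n^+$ and $B\in\mathbb{M}_m^+$,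 $$\lambda\bigl(\Phi(A^{p_\alpha})^{1/2}\Psi(B^{p_\alpha})\Phi(A^{p_\alpha})^{1/2}\bigr)\prec_{w(\log)}\lambda^{1-\alpha}\bigl(\Phi(A^{p_0})^{1/2}\Psi(B^{p_0})\Phi(A^{p_0})^{1/2}\bigr)\,\lambda^{\alpha}\bigl(\Phi(A^{p_1})^{1/2}\Psi(B^{p_1})\Phi(A^{p_1})^{1/2}\bigr),$$ or equivalently, $$s\bigl(\Phi(A^{p_\alpha})^{1/2}\Psi(B^{p_\alpha})^{1/2}\bigr)\prec_{w(\log)}s^{1-\alpha}\bigl(\Phi(A^{p_0})^{1/2}\Psi(B^{p_0})^{1/2}\bigr)\,s^{\alpha}\bigl(\Phi(A^{p_1})^{1/2}\Psi(B^{p_1})^{1/2}\bigr).$$ In particular, for every $A,B\in\mathbb{M}_n^+$, $$s(A^{p_\alpha}B^{p_\alpha})\prec_{(\log)}s^{1-\alpha}(A^{p_0}B^{p_0})\,s^{\alpha}(A^{p_1}B^{p_1}).$$ -/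

import Mathlib

open scoped MatrixOrder ComplexOrder

/-- The eigenvalues `λ₁(X) ≥ … ≥ λₙ(X)` of a positive semidefinite matrix, in decreasing order and
counted with multiplicity (`eigs X hX i` is `λ_{i+1}(X)`, as `Fin n` starts at `0`). -/
noncomputable def eigs {n : ℕ} (X : Matrix (Fin n) (Fin n) ℂ) (hX : X.PosSemidef) : Fin n → ℝ :=
  fun i => hX.isHermitian.eigenvalues₀ (Fin.cast (Fintype.card_fin n).symm i)

/-- The singular values `s₁(X) ≥ … ≥ sₙ(X)` of a square complex matrix (acting on Euclidean space),
in decreasing order and counted with multiplicity. -/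
noncomputable def sing {n : ℕ} (X : Matrix (Fin n) (Fin n) ℂ) : Fin n → ℝ :=
  fun i => (Matrix.toEuclideanLin X).singularValues i

/-- Weak log-majorization (log-submajorization) `a ≺_{w(log)} b` of decreasing nonnegative vectors:
the product of the first `k` entries of `a` is at most that of `b`, for `1 ≤ k ≤ n`. -/
def WeakLogMaj {n : ℕ} (a b : Fin n → ℝ) : Prop :=
  ∀ k : ℕ, 1 ≤ k → k ≤ n →
    ∏ i : Fin n with i.val < k, a i ≤ ∏ i : Fin n with i.val < k, b i

/-- Log-majorization `a ≺_{(log)} b` of decreasing nonnegative vectors: weak log-majorization with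
equality for `k = n`. -/
def LogMaj {n : ℕ} (a b : Fin n → ℝ) : Prop :=
  WeakLogMaj a b ∧ ∏ i, a i = ∏ i, b i

/-- The matrix `Φ(A^p)^{1/2} Ψ(B^p) Φ(A^p)^{1/2}`. Real powers are those of the continuous functional
calculus, with `0 ^ 0 = 1`, so that `A ^ 0` is the identity matrix. -/
noncomputable def sandwich {n m l : ℕ}
    (Φ : Matrix (Fin n) (Fin n) ℂ →ₚ[ℂ] Matrix (Fin l) (Fin l) ℂ)
    (Ψ : Matrix (Fin m) (Fin m) ℂ →ₚ[ℂ] Matrix (Fin l) (Fin l) ℂ)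
    (A : Matrix (Fin n) (Fin n) ℂ) (B : Matrix (Fin m) (Fin m) ℂ) (p : ℝ) :
    Matrix (Fin l) (Fin l) ℂ :=
  Φ (A ^ p) ^ (1 / 2 : ℝ) * Ψ (B ^ p) * Φ (A ^ p) ^ (1 / 2 : ℝ)

theorem sandwich_posSemidef {n m l : ℕ}
    (Φ : Matrix (Fin n) (Fin n) ℂ →ₚ[ℂ] Matrix (Fin l) (Fin l) ℂ)
    (Ψ : Matrix (Fin m) (Fin m) ℂ →ₚ[ℂ] Matrix (Fin l) (Fin l) ℂ)
    (A : Matrix (Fin n) (Fin n) ℂ) (B : Matrix (Fin m) (Fin m) ℂ) (p : ℝ) :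
    (sandwich Φ Ψ A B p).PosSemidef := by
  have hY : (Ψ (B ^ p)).PosSemidef :=
    Matrix.nonneg_iff_posSemidef.mp (map_nonneg Ψ CFC.rpow_nonneg)
  have hX : (Φ (A ^ p) ^ (1 / 2 : ℝ)).PosSemidef :=
    Matrix.nonneg_iff_posSemidef.mp CFC.rpow_nonneg
  have h := hY.mul_mul_conjTranspose_same (Φ (A ^ p) ^ (1 / 2 : ℝ))
  rwa [hX.isHermitian.eq] at h

/-!
Write `N p = Φ(A^p)^{1/2} Ψ(B^p)^{1/2}`. The matrix `sandwich Φ Ψ A B p` is `N p (N p)ᴴ`, so its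
eigenvalues are the squares of the singular values of `N p` (`eigs_sandwich`), and it suffices to show
that the product of the `k` largest singular values of `N p` is log-convex in `p`.

Let `A = ∑ i, x i • P i` be the spectral decomposition. Each `Φ (P i)` is positive semidefinite, so it
is `(X i)ᴴ X i` for some `X i`; stacking the `X i` into one column `X` gives `Φ(A^p) = Xᴴ x^p X`
for all `p`, with a nonnegative diagonal matrix `x` (`exists_factor_map_rpow`). Likewise
`Ψ(B^p) = Yᴴ y^p Y`. By polar decomposition (`exists_polar`), `N p` and `x^{p/2} X Yᴴ y^{p/2}` are
obtained from each other by multiplication with contractions on both sides.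

The product of the `k` largest singular values of a matrix `N` is the maximum of `|det (Uᴴ N V)|` over
contractions `U`, `V` with `k` columns (`norm_det_le_prod_sing`, `exists_norm_det_eq_prod_sing`). This
variational formula takes the place of the passage to antisymmetric tensor powers; it rests on the
inequality `det (Wᴴ P W) ≤ λ₁(P) ⋯ λₖ(P)` for positive semidefinite `P` and a contraction `W`
(`re_det_conjTranspose_mul_mul_le`). Log-convexity is then the Hadamard three lines theorem for the
entire function `z ↦ det (Uᴴ x^z X Yᴴ y^z V)`, since on a vertical line the imaginary powers of `x` and
`y` are contractions that can be absorbed into `U` and `V` (`norm_det_interpolation`).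

For `Φ = Ψ = id` and doubled exponents, `N (2p) = A^p B^p`, and the equality of the full products is the
multiplicativity of the determinant, `|det (A^p B^p)| = (det A * det B)^p`.
-/

open Matrix

/-! ### Monotonicity of the determinant, and contractions -/

theorem Matrix.PosSemidef.one_le_det_one_add {n : Type*} [Fintype n] [DecidableEq n]
    {P : Matrix n n ℂ} (hP : P.PosSemidef) : 1 ≤ (1 + P).det := by
  have h : (1 + P).det = ((∏ i, (1 + hP.isHermitian.eigenvalues i) : ℝ) : ℂ) := by
    conv_lhs => rw [hP.isHermitian.spectral_theorem]
    rw [← map_one (Unitary.conjStarAlgAut ℂ _ hP.isHermitian.eigenvectorUnitary), ← map_add,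
      ← diagonal_one, diagonal_add, Unitary.conjStarAlgAut_apply, det_mul_right_comm,
      ← Unitary.coe_star, Unitary.coe_mul_star_self, one_mul, det_diagonal]
    simp
  rw [h]
  exact_mod_cast Finset.one_le_prod fun i => by
    simpa using hP.eigenvalues_nonneg i

/-- The determinant is monotone on positive semidefinite matrices: if `A` is positive definite and
`B = A + Xᴴ X`, then `det B = det A * det (1 + X A⁻¹ Xᴴ)`. -/
theorem Matrix.PosSemidef.det_le_det {n : Type*} [Fintype n] [DecidableEq n]
    {A B : Matrix n n ℂ} (hA : A.PosSemidef) (hAB : A ≤ B) : A.det ≤ B.det := by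
  have hB : B.PosSemidef := nonneg_iff_posSemidef.mp ((nonneg_iff_posSemidef.mpr hA).trans hAB)
  by_cases h0 : A.det = 0
  · rw [h0]; exact hB.det_nonneg
  have hpd := hA.posDef_iff_det_ne_zero.mpr h0
  obtain ⟨X, hX⟩ := CStarAlgebra.nonneg_iff_eq_star_mul_self.mp (sub_nonneg.mpr hAB)
  rw [star_eq_conjTranspose] at hX
  have hBe : B = A * (1 + A⁻¹ * Xᴴ * X) := by
    rw [mul_add, mul_one, ← mul_assoc, ← mul_assoc, mul_nonsing_inv _ (isUnit_iff_ne_zero.mpr h0),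
      one_mul, ← hX]
    abel
  rw [hBe, det_mul, det_one_add_mul_comm, ← mul_assoc]
  refine le_mul_of_one_le_right hA.det_nonneg (PosSemidef.one_le_det_one_add ?_)
  exact hpd.posSemidef.inv.mul_mul_conjTranspose_same X

/-- If the rectangular matrix `W` is a contraction, that is `Wᴴ W ≤ 1`, then so is `Wᴴ`:
for `P = W Wᴴ` one has `P² ≤ P`, and `1 - P = (1 - P)² + (P - P²)`. -/
theorem Matrix.mul_conjTranspose_self_le_one {m n : Type*} [Fintype m] [DecidableEq m] [Fintype n]
    [DecidableEq n] {W : Matrix m n ℂ} (hW : Wᴴ * W ≤ 1) : W * Wᴴ ≤ 1 := by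
  have h1 : (W * (1 - Wᴴ * W) * Wᴴ).PosSemidef :=
    (le_iff.mp hW).mul_mul_conjTranspose_same W
  have h2 := posSemidef_conjTranspose_mul_self (1 - W * Wᴴ)
  rw [le_iff]
  convert! h1.add h2 using 1
  simp only [conjTranspose_sub, conjTranspose_one, conjTranspose_mul, conjTranspose_conjTranspose,
    Matrix.mul_sub, Matrix.sub_mul, Matrix.mul_one, Matrix.one_mul, Matrix.mul_assoc]
  abel

theorem Matrix.contraction_conjTranspose {m n : Type*} [Fintype m] [DecidableEq m] [Fintype n]
    [DecidableEq n] {W : Matrix m n ℂ} (hW : Wᴴ * W ≤ 1) : Wᴴᴴ * Wᴴ ≤ 1 := by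
  rw [conjTranspose_conjTranspose]
  exact mul_conjTranspose_self_le_one hW

theorem Matrix.conjTranspose_mul_mul_le {m n : Type*} [Fintype m] [Fintype n]
    {A B : Matrix m m ℂ} (h : A ≤ B) (V : Matrix m n ℂ) : Vᴴ * A * V ≤ Vᴴ * B * V := by
  rw [le_iff] at h ⊢
  convert! h.conjTranspose_mul_mul_same V using 1
  simp only [Matrix.mul_sub, Matrix.sub_mul]

theorem Matrix.contraction_mul {m n k : Type*} [Fintype m] [Fintype n] [Fintype k] [DecidableEq m]
    [DecidableEq n] [DecidableEq k] {U : Matrix m n ℂ} {V : Matrix n k ℂ}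
    (hU : Uᴴ * U ≤ 1) (hV : Vᴴ * V ≤ 1) : (U * V)ᴴ * (U * V) ≤ 1 := by
  have h := conjTranspose_mul_mul_le hU V
  rw [Matrix.mul_one] at h
  rw [conjTranspose_mul, Matrix.mul_assoc, ← Matrix.mul_assoc Uᴴ, ← Matrix.mul_assoc]
  exact h.trans hV

/-! ### Ordered eigenvalues and singular values -/

theorem eigs_nonneg {n : ℕ} {X : Matrix (Fin n) (Fin n) ℂ} (hX : X.PosSemidef) (i : Fin n) :
    0 ≤ eigs X hX i := by
  have := hX.eigenvalues_nonneg ((Fintype.equivOfCardEq (Fintype.card_fin _))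
    (Fin.cast (Fintype.card_fin n).symm i))
  simpa [IsHermitian.eigenvalues, eigs] using this

theorem eigs_antitone {n : ℕ} {X : Matrix (Fin n) (Fin n) ℂ} (hX : X.PosSemidef) :
    Antitone (eigs X hX) := fun _ _ hij => hX.isHermitian.eigenvalues₀_antitone hij

theorem exists_unitary_eq_diagonal_eigs {n : ℕ} {X : Matrix (Fin n) (Fin n) ℂ}
    (hX : X.PosSemidef) : ∃ Q : Matrix (Fin n) (Fin n) ℂ, Qᴴ * Q = 1 ∧ Q * Qᴴ = 1 ∧
      X = Q * diagonal (fun i => (eigs X hX i : ℂ)) * Qᴴ := by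
  let σ : Fin n ≃ Fin n := (finCongr (Fintype.card_fin n).symm).trans
    (Fintype.equivOfCardEq (Fintype.card_fin _))
  have hσ : ∀ i, eigs X hX i = hX.isHermitian.eigenvalues (σ i) := fun i => by
    simp [σ, IsHermitian.eigenvalues, eigs]
  let Q : Matrix (Fin n) (Fin n) ℂ := hX.isHermitian.eigenvectorUnitary
  have hQ1 : Qᴴ * Q = 1 := Unitary.coe_star_mul_self hX.isHermitian.eigenvectorUnitary
  have hQ2 : Q * Qᴴ = 1 := Unitary.coe_mul_star_self hX.isHermitian.eigenvectorUnitary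
  refine ⟨Q.submatrix id σ, ?_, ?_, ?_⟩
  · rw [conjTranspose_submatrix, submatrix_mul _ _ _ id _ Function.bijective_id |>.symm, hQ1,
      submatrix_one_equiv]
  · rw [conjTranspose_submatrix, submatrix_mul_equiv, hQ2, submatrix_id_id]
  · have hd : diagonal (fun i => (eigs X hX i : ℂ)) =
        (diagonal (RCLike.ofReal ∘ hX.isHermitian.eigenvalues) : Matrix _ _ ℂ).submatrix σ σ := by
      rw [submatrix_diagonal_equiv]; congr 1; ext i; simp [hσ]
    rw [hd, conjTranspose_submatrix, submatrix_mul_equiv, submatrix_mul_equiv, submatrix_id_id]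
    exact hX.isHermitian.spectral_theorem

theorem eigs_congr {n : ℕ} {X Y : Matrix (Fin n) (Fin n) ℂ} (hX : X.PosSemidef)
    (hY : Y.PosSemidef) (h : X.charpoly = Y.charpoly) : eigs X hX = eigs Y hY := by
  have h1 := hX.isHermitian.sort_roots_charpoly_eq_eigenvalues₀
  rw [h, hY.isHermitian.sort_roots_charpoly_eq_eigenvalues₀] at h1
  have h2 := List.ofFn_injective h1
  ext i
  simp [eigs, h2]

theorem sing_nonneg {n : ℕ} (N : Matrix (Fin n) (Fin n) ℂ) (i : Fin n) : 0 ≤ sing N i :=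
  LinearMap.singularValues_nonneg _ _

theorem sing_sq {n : ℕ} (N : Matrix (Fin n) (Fin n) ℂ) (i : Fin n) :
    sing N i ^ 2 = eigs (Nᴴ * N) (posSemidef_conjTranspose_mul_self N) i := by
  have h := (toEuclideanLin N).sq_singularValues_fin
    (finrank_euclideanSpace.trans rfl) (Fin.cast (Fintype.card_fin n).symm i)
  have h2 : LinearMap.adjoint (toEuclideanLin N) ∘ₗ toEuclideanLin N
      = toEuclideanLin (Nᴴ * N) := by
    rw [← toEuclideanLin_conjTranspose_eq_adjoint]
    ext; simp [toLpLin_apply]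
  simp only [eigs, IsHermitian.eigenvalues₀, sing]
  convert! h using 2
  exact h2.symm

theorem prod_filter_lt_eq {n k : ℕ} (hk : k ≤ n) (a : Fin n → ℝ) :
    ∏ i : Fin n with i.val < k, a i = ∏ j : Fin k, a (Fin.castLE hk j) := by
  symm
  refine Finset.prod_bij (fun j _ => Fin.castLE hk j) (by simp) (by simp) ?_ (by simp)
  intro b hb
  exact ⟨⟨b, (Finset.mem_filter.mp hb).2⟩, by simp, by ext; simp⟩

/-! ### Determinants of compressions of a positive semidefinite matrix -/

/-- The diagonal case, for a positive `t` separating the first `k` entries from the others. Raising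
the entries after the first `k` to `t` gives a diagonal matrix `t (1 + Rᴴ R)`, where `R` has only `k`
rows, so that `det (1 + (R Y)ᴴ (R Y)) = det (1 + (R Y) (R Y)ᴴ) ≤ det (1 + R Rᴴ)`. -/
theorem det_conjTranspose_diagonal_mul_le {n k : ℕ} (hk : k ≤ n) {lam : Fin n → ℝ}
    {t : ℝ} (ht : 0 < t) (hlt : ∀ i : Fin n, k ≤ i.val → lam i ≤ t)
    (hge : ∀ j : Fin k, t ≤ lam (Fin.castLE hk j))
    (hnn : ∀ i, 0 ≤ lam i)
    {Y : Matrix (Fin n) (Fin k) ℂ} (hY : Yᴴ * Y ≤ 1) :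
    (Yᴴ * diagonal (fun i => (lam i : ℂ)) * Y).det ≤
      ((∏ j : Fin k, lam (Fin.castLE hk j) : ℝ) : ℂ) := by
  let r : Fin k → ℝ := fun j => √(lam (Fin.castLE hk j) / t - 1)
  have hr : ∀ j, t * (1 + r j * r j) = lam (Fin.castLE hk j) := fun j => by
    have : 0 ≤ lam (Fin.castLE hk j) / t - 1 := by
      rw [sub_nonneg, le_div_iff₀ ht]; simpa using hge j
    rw [Real.mul_self_sqrt this]; field_simp; ring
  let R : Matrix (Fin k) (Fin n) ℂ := of fun j i => if i = Fin.castLE hk j then (r j : ℂ) else 0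
  have hRR : t • (1 + R * Rᴴ) = diagonal fun j => (lam (Fin.castLE hk j) : ℂ) := by
    ext i j
    rw [Matrix.smul_apply, Matrix.add_apply, mul_apply]
    simp only [R, conjTranspose_apply, of_apply, apply_ite star, star_zero, mul_ite, mul_zero,
      Finset.sum_ite_eq', Finset.mem_univ, if_true]
    rcases eq_or_ne i j with rfl | hij
    · simp only [one_apply_eq, if_true, diagonal_apply_eq, ← hr i]
      simp [mul_add]
    · have : Fin.castLE hk j ≠ Fin.castLE hk i := fun h => hij (Fin.castLE_injective hk h).symm
      simp [hij, this]
  have hle : diagonal (fun i => (lam i : ℂ)) ≤ t • (1 + Rᴴ * R) := by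
    have hd : t • (1 + Rᴴ * R) = diagonal fun i : Fin n =>
        ((if h : i.val < k then lam i else t : ℝ) : ℂ) := by
      ext i j
      rw [Matrix.smul_apply, Matrix.add_apply, mul_apply]
      simp only [R, conjTranspose_apply, of_apply, apply_ite star, star_zero, mul_ite, mul_zero]
      rcases eq_or_ne i j with rfl | hij
      · by_cases h : i.val < k
        · rw [Finset.sum_eq_single (⟨i, h⟩ : Fin k)]
          · have := hr ⟨i, h⟩
            simp only [Fin.castLE_mk, Fin.eta] at this
            simp [h, ← this, mul_add]
          · intro b _ hb
            rw [if_neg]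
            intro h'
            exact hb (by ext; simp [h'])
          · simp
        · rw [Finset.sum_eq_zero]
          · simp [h]
          · intro b _
            rw [if_neg]
            intro h'
            exact h (by rw [h']; simp)
      · rw [Finset.sum_eq_zero]
        · simp [hij]
        · intro b _
          by_cases h1 : j = Fin.castLE hk b
          · have : i ≠ Fin.castLE hk b := fun h => hij (h.trans h1.symm)
            simp [this]
          · simp [h1]
    rw [hd, le_iff, diagonal_sub]
    refine PosSemidef.diagonal fun i => ?_
    by_cases h : i.val < k
    · simp [h]
    · simp only [h, dif_neg, not_false_eq_true, Pi.zero_apply]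
      exact_mod_cast sub_nonneg.mpr (hlt i (not_lt.mp h))
  have h0 : (Yᴴ * diagonal (fun i => (lam i : ℂ)) * Y).PosSemidef :=
    (PosSemidef.diagonal fun i => by simpa using hnn i).conjTranspose_mul_mul_same Y
  have h1 : Yᴴ * (t • (1 + Rᴴ * R)) * Y ≤ t • (1 + (R * Y)ᴴ * (R * Y)) := by
    have : t • (1 + (R * Y)ᴴ * (R * Y)) - Yᴴ * (t • (1 + Rᴴ * R)) * Y = t • (1 - Yᴴ * Y) := by
      simp only [conjTranspose_mul, Matrix.mul_smul, Matrix.smul_mul, Matrix.mul_add,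
        Matrix.add_mul, Matrix.mul_one, Matrix.mul_assoc, ← smul_sub]
      congr 1
      abel
    rw [le_iff, this]
    exact (le_iff.mp hY).smul ht.le
  have h2 : (1 + (R * Y) * (R * Y)ᴴ) ≤ 1 + R * Rᴴ := by
    have := conjTranspose_mul_mul_le (mul_conjTranspose_self_le_one hY) Rᴴ
    rw [conjTranspose_conjTranspose, Matrix.mul_one] at this
    refine add_le_add_right ?_ 1
    simpa only [conjTranspose_mul, Matrix.mul_assoc] using this
  have hd (M : Matrix (Fin k) (Fin k) ℂ) : (t • M).det = (t : ℂ) ^ k * M.det := by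
    rw [← Complex.coe_smul, det_smul, Fintype.card_fin]
  calc (Yᴴ * diagonal (fun i => (lam i : ℂ)) * Y).det
      ≤ (t • (1 + (R * Y)ᴴ * (R * Y))).det :=
        h0.det_le_det ((conjTranspose_mul_mul_le hle Y).trans h1)
    _ = (t • (1 + (R * Y) * (R * Y)ᴴ)).det := by rw [hd, hd, det_one_add_mul_comm]
    _ ≤ (t • (1 + R * Rᴴ)).det := by
        rw [hd, hd]
        refine mul_le_mul_of_nonneg_left ?_ (by exact_mod_cast (pow_pos ht k).le)
        exact (PosSemidef.one.add (posSemidef_self_mul_conjTranspose _)).det_le_det h2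
    _ = _ := by rw [hRR, det_diagonal]; push_cast; rfl

/-- The compression of a positive semidefinite matrix `X` to `k` dimensions by a contraction `W` has
determinant at most the product of the `k` largest eigenvalues of `X`. -/
theorem re_det_conjTranspose_mul_mul_le {n k : ℕ} (hk : k ≤ n) (hk1 : 1 ≤ k)
    {X : Matrix (Fin n) (Fin n) ℂ} (hX : X.PosSemidef) {W : Matrix (Fin n) (Fin k) ℂ}
    (hW : Wᴴ * W ≤ 1) :
    (Wᴴ * X * W).det.re ≤ ∏ j : Fin k, eigs X hX (Fin.castLE hk j) := by
  obtain ⟨Q, hQ1, hQ2, hQX⟩ := exists_unitary_eq_diagonal_eigs hX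
  have hY : (Qᴴ * W)ᴴ * (Qᴴ * W) ≤ 1 := by
    rw [conjTranspose_mul, conjTranspose_conjTranspose, Matrix.mul_assoc, ← Matrix.mul_assoc Q,
      hQ2, Matrix.one_mul]
    exact hW
  have hle (M : Matrix (Fin n) (Fin n) ℂ) (hM : X ≤ M) : (Wᴴ * X * W).det ≤ (Wᴴ * M * W).det :=
    (hX.conjTranspose_mul_mul_same W).det_le_det (conjTranspose_mul_mul_le hM W)
  -- Adding `ε` to every eigenvalue makes the threshold `t` of the diagonal case positive.
  have key (ε : ℝ) (hε : 0 < ε) :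
      (Wᴴ * X * W).det.re ≤ ∏ j : Fin k, (eigs X hX (Fin.castLE hk j) + ε) := by
    have h := det_conjTranspose_diagonal_mul_le hk (lam := fun i => eigs X hX i + ε)
      (t := eigs X hX ⟨k - 1, by omega⟩ + ε) (add_pos_of_nonneg_of_pos (eigs_nonneg hX _) hε)
      (fun i hi => by
        have : eigs X hX i ≤ eigs X hX ⟨k - 1, by omega⟩ :=
          eigs_antitone hX (Fin.le_def.mpr (by simp only; omega))
        linarith)
      (fun j => by
        have : eigs X hX ⟨k - 1, by omega⟩ ≤ eigs X hX (Fin.castLE hk j) :=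
          eigs_antitone hX (Fin.le_def.mpr (by simp only [Fin.val_castLE]; omega))
        linarith)
      (fun i => add_nonneg (eigs_nonneg hX i) hε.le) hY
    have h2 := hle (Q * diagonal (fun i => ((eigs X hX i + ε : ℝ) : ℂ)) * Qᴴ) (by
      conv_lhs => rw [hQX]
      have := conjTranspose_mul_mul_le (A := diagonal (fun i => (eigs X hX i : ℂ)))
        (B := diagonal (fun i => ((eigs X hX i + ε : ℝ) : ℂ))) (by
          rw [le_iff, diagonal_sub]
          exact PosSemidef.diagonal fun i => by simpa using hε.le) Qᴴ
      rwa [conjTranspose_conjTranspose] at this)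
    have h3 : Wᴴ * (Q * diagonal (fun i => ((eigs X hX i + ε : ℝ) : ℂ)) * Qᴴ) * W =
        (Qᴴ * W)ᴴ * diagonal (fun i => ((eigs X hX i + ε : ℝ) : ℂ)) * (Qᴴ * W) := by
      simp only [conjTranspose_mul, conjTranspose_conjTranspose, Matrix.mul_assoc]
    rw [h3] at h2
    simpa only [Complex.ofReal_re] using (Complex.le_def.mp (h2.trans h)).1
  have hlim : Filter.Tendsto (fun ε : ℝ => ∏ j : Fin k, (eigs X hX (Fin.castLE hk j) + ε))
      (nhdsWithin 0 (Set.Ioi 0)) (nhds (∏ j : Fin k, (eigs X hX (Fin.castLE hk j) + 0))) :=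
    ((by fun_prop : Continuous fun ε : ℝ => ∏ j : Fin k,
      (eigs X hX (Fin.castLE hk j) + ε)).tendsto 0).mono_left nhdsWithin_le_nhds
  simp only [add_zero] at hlim
  exact ge_of_tendsto hlim (Filter.eventually_of_mem self_mem_nhdsWithin key)

/-- The columns of `W` are eigenvectors for the `k` largest eigenvalues. -/
theorem exists_det_conjTranspose_mul_mul_eq {n k : ℕ} (hk : k ≤ n)
    {X : Matrix (Fin n) (Fin n) ℂ} (hX : X.PosSemidef) :
    ∃ W : Matrix (Fin n) (Fin k) ℂ, Wᴴ * W ≤ 1 ∧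
      (Wᴴ * X * W).det = ((∏ j : Fin k, eigs X hX (Fin.castLE hk j) : ℝ) : ℂ) := by
  obtain ⟨Q, hQ1, hQ2, hQX⟩ := exists_unitary_eq_diagonal_eigs hX
  refine ⟨Q.submatrix id (Fin.castLE hk), ?_, ?_⟩
  · rw [conjTranspose_submatrix, ← submatrix_mul _ _ _ id _ Function.bijective_id, hQ1,
      submatrix_one _ (Fin.castLE_injective hk)]
  · have h : Qᴴ * X * Q = diagonal (fun i => (eigs X hX i : ℂ)) := by
      conv_lhs => rw [hQX]
      rw [← Matrix.mul_assoc, ← Matrix.mul_assoc, hQ1, Matrix.one_mul, Matrix.mul_assoc, hQ1,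
        Matrix.mul_one]
    have h2 : (Q.submatrix id (Fin.castLE hk))ᴴ * X * Q.submatrix id (Fin.castLE hk) =
        (Qᴴ * X * Q).submatrix (Fin.castLE hk) (Fin.castLE hk) := by
      rw [conjTranspose_submatrix, submatrix_mul (Qᴴ * X) Q _ id _ Function.bijective_id,
        submatrix_mul Qᴴ X _ id _ Function.bijective_id, submatrix_id_id]
    rw [h2, h, submatrix_diagonal _ _ (Fin.castLE_injective hk), det_diagonal]
    push_cast
    rfl

/-! ### Polar decomposition -/

theorem Matrix.PosSemidef.rpow_half_mul_self {n : Type*} [Fintype n] [DecidableEq n]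
    {P : Matrix n n ℂ} (hP : P.PosSemidef) : P ^ (1 / 2 : ℝ) * P ^ (1 / 2 : ℝ) = P := by
  have h0 := nonneg_iff_posSemidef.mpr hP
  rw [← CFC.sqrt_eq_rpow, CFC.sqrt_mul_sqrt_self P h0]

theorem Matrix.conjTranspose_rpow {n : Type*} [Fintype n] [DecidableEq n]
    (P : Matrix n n ℂ) (p : ℝ) : (P ^ p)ᴴ = P ^ p :=
  (nonneg_iff_posSemidef.mp CFC.rpow_nonneg).isHermitian.eq

/-- Polar decomposition with a contraction `U = S G`, where `G` is the pseudo-inverse of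
`H = (Sᴴ S)^{1/2}`. The extra identity `Uᴴ S = H` says that `U` is isometric on the range of `H`. -/
theorem exists_polar {m n : Type*} [Fintype m] [Fintype n] [DecidableEq n] (S : Matrix m n ℂ) :
    ∃ U : Matrix m n ℂ, Uᴴ * U ≤ 1 ∧ U * (Sᴴ * S) ^ (1 / 2 : ℝ) = S ∧
      Uᴴ * S = (Sᴴ * S) ^ (1 / 2 : ℝ) := by
  set P := Sᴴ * S with hPdef
  have hP : P.PosSemidef := posSemidef_conjTranspose_mul_self S
  have h0 : 0 ≤ P := nonneg_iff_posSemidef.mpr hP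
  have hsa : IsSelfAdjoint P := hP.isHermitian
  have hc (f : ℝ → ℝ) : ContinuousOn f (spectrum ℝ P) := P.finite_real_spectrum.continuousOn f
  have hsp : ∀ x ∈ spectrum ℝ P, 0 ≤ x := fun x hx => spectrum_nonneg_of_nonneg h0 hx
  let G := cfc (fun x : ℝ => (√x)⁻¹) P
  have hG : Gᴴ = G := (cfc_predicate (fun x : ℝ => (√x)⁻¹) P : IsSelfAdjoint G)
  have hH : P ^ (1 / 2 : ℝ) = cfc Real.sqrt P := by
    rw [CFC.rpow_eq_cfc_real h0]
    exact cfc_congr fun x _ => (Real.sqrt_eq_rpow x).symm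
  have hGP : G * P = cfc Real.sqrt P := by
    trans cfc (fun x : ℝ => (√x)⁻¹) P * cfc (fun x : ℝ => x) P
    · rw [cfc_id' ℝ P]
    rw [← cfc_mul _ _ P (hc _) (hc _)]
    refine cfc_congr fun x hx => ?_
    rcases (hsp x hx).eq_or_lt with rfl | hx
    · simp
    · simp only [inv_mul_eq_div, Real.div_sqrt]
  have hPGH : P * (G * cfc Real.sqrt P) = P := by
    trans cfc (fun x : ℝ => x) P * (cfc (fun x : ℝ => (√x)⁻¹) P * cfc Real.sqrt P)
    · rw [cfc_id' ℝ P]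
    conv_rhs => rw [← cfc_id' ℝ P]
    rw [← cfc_mul _ _ P (hc _) (hc _), ← cfc_mul _ _ P (hc _) (hc _)]
    refine cfc_congr fun x hx => ?_
    rcases (hsp x hx).eq_or_lt with rfl | hx
    · simp
    · have := (Real.sqrt_pos.mpr hx).ne'
      simp [this]
  refine ⟨S * G, ?_, ?_, ?_⟩
  · rw [conjTranspose_mul, hG, Matrix.mul_assoc, ← Matrix.mul_assoc Sᴴ, ← hPdef,
      ← Matrix.mul_assoc, hGP, ← cfc_mul _ _ P (hc _) (hc _)]
    exact cfc_le_one _ _ fun x _ => mul_inv_le_one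
  · rw [hH, Matrix.mul_assoc, ← sub_eq_zero]
    set K := G * cfc Real.sqrt P
    have h1 : S * K - S = S * (K - 1) := by rw [Matrix.mul_sub, Matrix.mul_one]
    have h2 : Sᴴ * S * (K - 1) = 0 := by
      rw [Matrix.mul_sub, Matrix.mul_one, ← hPdef, hPGH, sub_self]
    rw [h1, ← conjTranspose_mul_self_eq_zero, conjTranspose_mul, Matrix.mul_assoc,
      ← Matrix.mul_assoc Sᴴ, h2, Matrix.mul_zero]
  · rw [conjTranspose_mul, hG, Matrix.mul_assoc, ← hPdef, hGP, hH]

/-! ### Products of singular values as maxima of determinants -/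

theorem ofReal_norm_det_sq {k : Type*} [Fintype k] [DecidableEq k] (M : Matrix k k ℂ) :
    ((‖M.det‖ ^ 2 : ℝ) : ℂ) = (Mᴴ * M).det := by
  rw [det_mul, det_conjTranspose, RCLike.star_def, Complex.conj_mul']
  push_cast
  rfl

theorem prod_sing_sq {n k : ℕ} (hk : k ≤ n) (N : Matrix (Fin n) (Fin n) ℂ) :
    (∏ j : Fin k, sing N (Fin.castLE hk j)) ^ 2 =
      ∏ j : Fin k, eigs (Nᴴ * N) (posSemidef_conjTranspose_mul_self N) (Fin.castLE hk j) := by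
  rw [← Finset.prod_pow]
  exact Finset.prod_congr rfl fun _ _ => sing_sq N _

theorem prod_sing_nonneg {n k : ℕ} (hk : k ≤ n) (N : Matrix (Fin n) (Fin n) ℂ) :
    0 ≤ ∏ j : Fin k, sing N (Fin.castLE hk j) :=
  Finset.prod_nonneg fun _ _ => sing_nonneg N _

theorem norm_det_le_prod_sing {n k : ℕ} (hk : k ≤ n) (hk1 : 1 ≤ k)
    (N : Matrix (Fin n) (Fin n) ℂ) {U V : Matrix (Fin n) (Fin k) ℂ} (hU : Uᴴ * U ≤ 1)
    (hV : Vᴴ * V ≤ 1) :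
    ‖(Uᴴ * N * V).det‖ ≤ ∏ j : Fin k, sing N (Fin.castLE hk j) := by
  refine le_of_sq_le_sq ?_ (prod_sing_nonneg hk N)
  rw [prod_sing_sq]
  refine le_trans ?_ (re_det_conjTranspose_mul_mul_le hk hk1
    (posSemidef_conjTranspose_mul_self N) hV)
  have h := conjTranspose_mul_mul_le (mul_conjTranspose_self_le_one hU) (N * V)
  have h2 : ((Uᴴ * N * V)ᴴ * (Uᴴ * N * V)).det ≤ (Vᴴ * (Nᴴ * N) * V).det := by
    refine (posSemidef_conjTranspose_mul_self _).det_le_det ?_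
    simpa only [conjTranspose_mul, conjTranspose_conjTranspose, Matrix.mul_assoc,
      Matrix.one_mul] using h
  rw [← ofReal_norm_det_sq] at h2
  simpa only [Complex.ofReal_re] using (Complex.le_def.mp h2).1

/-- The columns of `V` are the first `k` right singular vectors of `N`, and `U` is the polar factor of
`N V`. -/
theorem exists_norm_det_eq_prod_sing {n k : ℕ} (hk : k ≤ n)
    (N : Matrix (Fin n) (Fin n) ℂ) :
    ∃ U V : Matrix (Fin n) (Fin k) ℂ, Uᴴ * U ≤ 1 ∧ Vᴴ * V ≤ 1 ∧
      ‖(Uᴴ * N * V).det‖ = ∏ j : Fin k, sing N (Fin.castLE hk j) := by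
  obtain ⟨V, hV, hdet⟩ :=
    exists_det_conjTranspose_mul_mul_eq hk (posSemidef_conjTranspose_mul_self N)
  obtain ⟨U, hU, -, hUN⟩ := exists_polar (N * V)
  refine ⟨U, V, hU, hV, ?_⟩
  rw [← sq_eq_sq₀ (norm_nonneg _) (prod_sing_nonneg hk N), prod_sing_sq, ← Complex.ofReal_inj,
    ofReal_norm_det_sq, ← hdet, Matrix.mul_assoc, hUN, conjTranspose_rpow,
    (posSemidef_conjTranspose_mul_self _).rpow_half_mul_self]
  simp only [conjTranspose_mul, Matrix.mul_assoc]

/-- By polar decomposition, `S Tᴴ = U₁ (Sᴴ S)^{1/2} (Tᴴ T)^{1/2} U₂ᴴ` with contractions `U₁`, `U₂`. -/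
theorem norm_det_le_prod_sing_of_factor {a b : Type*} [Fintype a] [DecidableEq a] [Fintype b]
    [DecidableEq b] {l k : ℕ} (hk : k ≤ l) (hk1 : 1 ≤ k) (S : Matrix a (Fin l) ℂ)
    (T : Matrix b (Fin l) ℂ) {U : Matrix a (Fin k) ℂ} {V : Matrix b (Fin k) ℂ}
    (hU : Uᴴ * U ≤ 1) (hV : Vᴴ * V ≤ 1) :
    ‖(Uᴴ * (S * Tᴴ) * V).det‖ ≤
      ∏ j : Fin k, sing ((Sᴴ * S) ^ (1 / 2 : ℝ) * (Tᴴ * T) ^ (1 / 2 : ℝ)) (Fin.castLE hk j) := by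
  obtain ⟨U₁, hU₁, hS, -⟩ := exists_polar S
  obtain ⟨U₂, hU₂, hT, -⟩ := exists_polar T
  have h1 : (U₁ᴴ * U)ᴴ * (U₁ᴴ * U) ≤ 1 :=
    contraction_mul (contraction_conjTranspose hU₁) hU
  have h2 : (U₂ᴴ * V)ᴴ * (U₂ᴴ * V) ≤ 1 :=
    contraction_mul (contraction_conjTranspose hU₂) hV
  have h := norm_det_le_prod_sing hk hk1
    ((Sᴴ * S) ^ (1 / 2 : ℝ) * (Tᴴ * T) ^ (1 / 2 : ℝ)) h1 h2
  have he : (U₁ᴴ * U)ᴴ * ((Sᴴ * S) ^ (1 / 2 : ℝ) * (Tᴴ * T) ^ (1 / 2 : ℝ)) * (U₂ᴴ * V) =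
      Uᴴ * (U₁ * (Sᴴ * S) ^ (1 / 2 : ℝ) * (U₂ * (Tᴴ * T) ^ (1 / 2 : ℝ))ᴴ) * V := by
    rw [conjTranspose_mul U₂, conjTranspose_rpow, conjTranspose_mul, conjTranspose_conjTranspose]
    simp only [Matrix.mul_assoc]
  rwa [he, hS, hT] at h

/-- The bound of `norm_det_le_prod_sing_of_factor` is attained, as conversely
`(Sᴴ S)^{1/2} (Tᴴ T)^{1/2} = U₁ᴴ (S Tᴴ) U₂` for the contractions of the polar decompositions. -/
theorem exists_norm_det_eq_prod_sing_of_factor {a b : Type*} [Fintype a] [DecidableEq a]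
    [Fintype b] [DecidableEq b] {l k : ℕ} (hk : k ≤ l) (S : Matrix a (Fin l) ℂ)
    (T : Matrix b (Fin l) ℂ) :
    ∃ (U : Matrix a (Fin k) ℂ) (V : Matrix b (Fin k) ℂ), Uᴴ * U ≤ 1 ∧ Vᴴ * V ≤ 1 ∧
      ‖(Uᴴ * (S * Tᴴ) * V).det‖ =
      ∏ j : Fin k, sing ((Sᴴ * S) ^ (1 / 2 : ℝ) * (Tᴴ * T) ^ (1 / 2 : ℝ)) (Fin.castLE hk j) := by
  obtain ⟨U₁, hU₁, -, hS⟩ := exists_polar S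
  obtain ⟨U₂, hU₂, -, hT⟩ := exists_polar T
  obtain ⟨U, V, hU, hV, h⟩ := exists_norm_det_eq_prod_sing hk
    ((Sᴴ * S) ^ (1 / 2 : ℝ) * (Tᴴ * T) ^ (1 / 2 : ℝ))
  refine ⟨U₁ * U, U₂ * V, contraction_mul hU₁ hU, contraction_mul hU₂ hV, ?_⟩
  have hT' := congrArg conjTranspose hT
  rw [conjTranspose_mul, conjTranspose_conjTranspose, conjTranspose_rpow] at hT'
  rw [← h, ← hS, ← hT']
  simp only [conjTranspose_mul, Matrix.mul_assoc]

/-! ### Interpolation of determinants by the three lines theorem -/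

/-- The power `x ^ z` of a real number `x ≥ 0` with a complex exponent, with `0 ^ z = 0` for every
`z`, including `z = 0`. Thus it is entire in `z`, whatever `x` is. -/
noncomputable def entirePow (x : ℝ) (z : ℂ) : ℂ :=
  if x = 0 then 0 else Complex.exp (z * Real.log x)

@[fun_prop]
theorem differentiable_entirePow (x : ℝ) : Differentiable ℂ (entirePow x) := by
  unfold entirePow
  split_ifs
  · fun_prop
  · fun_prop

theorem entirePow_ofReal {x : ℝ} (hx : 0 ≤ x) {p : ℝ} (hp : p ≠ 0) :
    entirePow x p = ((x ^ p : ℝ) : ℂ) := by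
  unfold entirePow
  split_ifs with h
  · simp [h, Real.zero_rpow hp]
  · rw [Real.rpow_def_of_pos (hx.lt_of_ne' h)]
    push_cast
    rw [mul_comm]

theorem norm_entirePow_le {x : ℝ} (hx : 0 ≤ x) (z : ℂ) : ‖entirePow x z‖ ≤ x ^ z.re := by
  unfold entirePow
  split_ifs with h
  · simpa using Real.rpow_nonneg hx _
  · rw [Real.rpow_def_of_pos (hx.lt_of_ne' h), Complex.norm_exp]
    simp [mul_comm]

theorem exists_entirePow_eq {x : ℝ} (hx : 0 ≤ x) (z : ℂ) :
    ∃ u : ℂ, ‖u‖ ≤ 1 ∧ entirePow x z = u * ((x ^ z.re : ℝ) : ℂ) := by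
  have h := norm_entirePow_le hx z
  rcases (Real.rpow_nonneg hx z.re).eq_or_lt' with h0 | h0
  · rw [h0] at h ⊢
    exact ⟨0, by simp, by simpa using h⟩
  · refine ⟨entirePow x z / ((x ^ z.re : ℝ) : ℂ), ?_, ?_⟩
    · rw [norm_div, Complex.norm_real, Real.norm_of_nonneg h0.le]
      exact (div_le_one h0).mpr h
    · rw [div_mul_cancel₀]
      exact_mod_cast h0.ne'

theorem differentiable_det {k : Type*} [Fintype k] [DecidableEq k] {F : ℂ → Matrix k k ℂ}
    (h : ∀ i j, Differentiable ℂ fun z => F z i j) : Differentiable ℂ fun z => (F z).det := by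
  simp only [det_apply]
  fun_prop

theorem contraction_diagonal {m : Type*} [Fintype m] [DecidableEq m] {u : m → ℂ}
    (hu : ∀ i, ‖u i‖ ≤ 1) : (diagonal u)ᴴ * diagonal u ≤ 1 := by
  rw [diagonal_conjTranspose, diagonal_mul_diagonal, ← diagonal_one, le_iff, diagonal_sub]
  refine PosSemidef.diagonal fun i => ?_
  simp only [Pi.zero_apply, Pi.star_apply, RCLike.star_def, Complex.conj_mul', sub_nonneg]
  exact_mod_cast pow_le_one₀ (norm_nonneg _) (hu i)

/-- The three lines theorem for the function `z ↦ det (Uᴴ x^z M y^z V)`: on a vertical line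
`Re z = q`, the powers are `x^q` and `y^q` up to contractions, which can be absorbed into `U`, `V`. -/
theorem norm_det_interpolation {a b k : Type*} [Fintype a] [DecidableEq a] [Fintype b]
    [DecidableEq b] [Fintype k] [DecidableEq k] (M : Matrix a b ℂ) {x : a → ℝ} {y : b → ℝ}
    (hx : ∀ i, 0 ≤ x i) (hy : ∀ i, 0 ≤ y i) {q₀ q₁ α C₀ C₁ : ℝ} (hα₀ : 0 ≤ α) (hα₁ : α ≤ 1)
    (hq : (1 - α) * q₀ + α * q₁ ≠ 0)
    (h₀ : ∀ (U : Matrix a k ℂ) (V : Matrix b k ℂ), Uᴴ * U ≤ 1 → Vᴴ * V ≤ 1 →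
      ‖(Uᴴ * (diagonal (fun i => ((x i ^ q₀ : ℝ) : ℂ)) * M *
        diagonal (fun i => ((y i ^ q₀ : ℝ) : ℂ))) * V).det‖ ≤ C₀)
    (h₁ : ∀ (U : Matrix a k ℂ) (V : Matrix b k ℂ), Uᴴ * U ≤ 1 → Vᴴ * V ≤ 1 →
      ‖(Uᴴ * (diagonal (fun i => ((x i ^ q₁ : ℝ) : ℂ)) * M *
        diagonal (fun i => ((y i ^ q₁ : ℝ) : ℂ))) * V).det‖ ≤ C₁)
    {U : Matrix a k ℂ} {V : Matrix b k ℂ} (hU : Uᴴ * U ≤ 1) (hV : Vᴴ * V ≤ 1) :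
    ‖(Uᴴ * (diagonal (fun i => ((x i ^ ((1 - α) * q₀ + α * q₁) : ℝ) : ℂ)) * M *
        diagonal (fun i => ((y i ^ ((1 - α) * q₀ + α * q₁) : ℝ) : ℂ))) * V).det‖ ≤
      C₀ ^ (1 - α) * C₁ ^ α := by
  let G : (a → ℂ) × (b → ℂ) → ℂ := fun d =>
    (Uᴴ * (diagonal d.1 * M * diagonal d.2) * V).det
  let s : ℂ → ℂ := fun w => (1 - w) * q₀ + w * q₁
  have hsre (w : ℂ) : (s w).re = (1 - w.re) * q₀ + w.re * q₁ := by simp [s]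
  let f : ℂ → ℂ := fun w => G (fun i => entirePow (x i) (s w), fun i => entirePow (y i) (s w))
  have hGc : Continuous G := by fun_prop
  have hf : Differentiable ℂ f := by
    refine differentiable_det fun i j => ?_
    have hent (d : a → ℂ) (e : b → ℂ) :
        diagonal d * M * diagonal e = of fun i j => d i * M i j * e j := by
      ext i j
      rw [mul_diagonal, diagonal_mul, of_apply]
    simp only [hent, mul_apply, of_apply, s]
    fun_prop
  -- On the strip, every power occurring in `f` has modulus at most `exp ((|q₀| + |q₁|) |log r|)`.
  have hbd (r : ℝ) (w : ℂ) (hw : w ∈ Complex.HadamardThreeLines.verticalClosedStrip 0 1) :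
      entirePow r (s w) ∈ Metric.closedBall (0 : ℂ) (Real.exp ((|q₀| + |q₁|) * |Real.log r|)) := by
    rw [mem_closedBall_zero_iff]
    unfold entirePow
    split_ifs with h
    · simpa using (Real.exp_pos _).le
    · rw [Complex.norm_exp, Real.exp_le_exp, Complex.re_mul_ofReal, hsre]
      obtain ⟨hw0, hw1⟩ := hw
      refine (le_abs_self _).trans ?_
      rw [abs_mul]
      gcongr
      refine (abs_add_le _ _).trans ?_
      rw [abs_mul, abs_mul, abs_of_nonneg hw0, abs_of_nonneg (sub_nonneg.mpr hw1)]
      exact add_le_add (mul_le_of_le_one_left (abs_nonneg _) (by linarith))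
        (mul_le_of_le_one_left (abs_nonneg _) hw1)
  have hB : BddAbove ((norm ∘ f) '' Complex.HadamardThreeLines.verticalClosedStrip 0 1) := by
    have hK := (isCompact_univ_pi fun i : a => isCompact_closedBall (0 : ℂ)
        (Real.exp ((|q₀| + |q₁|) * |Real.log (x i)|))).prod
      (isCompact_univ_pi fun i : b => isCompact_closedBall (0 : ℂ)
        (Real.exp ((|q₀| + |q₁|) * |Real.log (y i)|)))
    refine (hK.bddAbove_image (f := fun d => ‖G d‖) hGc.norm.continuousOn).mono ?_
    rintro _ ⟨w, hw, rfl⟩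
    exact ⟨_, ⟨fun _ _ => hbd _ w hw, fun _ _ => hbd _ w hw⟩, rfl⟩
  have hline (q C : ℝ) (h : ∀ (U : Matrix a k ℂ) (V : Matrix b k ℂ), Uᴴ * U ≤ 1 → Vᴴ * V ≤ 1 →
      ‖(Uᴴ * (diagonal (fun i => ((x i ^ q : ℝ) : ℂ)) * M *
        diagonal (fun i => ((y i ^ q : ℝ) : ℂ))) * V).det‖ ≤ C) (w : ℂ) (hw : (s w).re = q) :
      ‖f w‖ ≤ C := by
    choose u hu1 hu using fun i => exists_entirePow_eq (hx i) (s w)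
    choose v hv1 hv using fun i => exists_entirePow_eq (hy i) (s w)
    have hU' := contraction_mul (contraction_conjTranspose (contraction_diagonal hu1)) hU
    have hV' := contraction_mul (contraction_diagonal hv1) hV
    refine le_of_eq_of_le ?_ (h _ _ hU' hV')
    simp only [f, G, hu, hv, hw]
    rw [← diagonal_mul_diagonal, funext fun i => mul_comm (v i) _, ← diagonal_mul_diagonal]
    simp only [conjTranspose_mul, conjTranspose_conjTranspose, Matrix.mul_assoc]
  have key := Complex.HadamardThreeLines.norm_le_interp_of_mem_verticalClosedStrip₀₁' f
    (z := (α : ℂ)) (a := C₀) (b := C₁) ⟨by simpa using hα₀, by simpa using hα₁⟩ hf.diffContOnCl hB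
    (fun w hw => hline q₀ C₀ h₀ w (by
      rw [hsre, show w.re = 0 from hw]; ring))
    (fun w hw => hline q₁ C₁ h₁ w (by
      rw [hsre, show w.re = 1 from hw]; ring))
  have hs : s α = (((1 - α) * q₀ + α * q₁ : ℝ) : ℂ) := by simp [s]
  simpa only [f, G, hs, entirePow_ofReal (hx _) hq, entirePow_ofReal (hy _) hq,
    Complex.ofReal_re] using key

/-! ### Positive maps on the powers of a positive semidefinite matrix -/

theorem rpow_eq_sum_vecMulVec {n : ℕ} {A : Matrix (Fin n) (Fin n) ℂ} (hA : A.PosSemidef) (p : ℝ) :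
    A ^ p = ∑ i, ((hA.isHermitian.eigenvalues i ^ p : ℝ) : ℂ) •
      vecMulVec (fun r => hA.isHermitian.eigenvectorUnitary.1 r i)
        (star fun r => hA.isHermitian.eigenvectorUnitary.1 r i) := by
  rw [CFC.rpow_eq_cfc_real (nonneg_iff_posSemidef.mpr hA), hA.isHermitian.cfc_eq,
    IsHermitian.cfc, Unitary.conjStarAlgAut_apply]
  ext r s
  rw [mul_apply]
  simp only [mul_diagonal, Matrix.sum_apply, Matrix.smul_apply, vecMulVec_apply,
    Function.comp_apply, star_apply, Pi.star_apply, smul_eq_mul]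
  refine Finset.sum_congr rfl fun i _ => ?_
  simp only [Complex.coe_algebraMap]
  ring

/-- A positive map is completely positive on the commutative algebra generated by `A`. Concretely,
with `A = ∑ i, x i • P i` the spectral decomposition and `Φ (P i) = (X i)ᴴ X i`, the column `X` of
the blocks `X i` satisfies `Φ (A ^ p) = Xᴴ x^p X`. -/
theorem exists_factor_map_rpow {n l : ℕ}
    (Φ : Matrix (Fin n) (Fin n) ℂ →ₚ[ℂ] Matrix (Fin l) (Fin l) ℂ)
    {A : Matrix (Fin n) (Fin n) ℂ} (hA : A.PosSemidef) :
    ∃ (x : Fin n × Fin l → ℝ) (X : Matrix (Fin n × Fin l) (Fin l) ℂ), (∀ i, 0 ≤ x i) ∧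
      ∀ p : ℝ, 0 ≤ p → (diagonal (fun i => ((x i ^ (p / 2) : ℝ) : ℂ)) * X)ᴴ *
        (diagonal (fun i => ((x i ^ (p / 2) : ℝ) : ℂ)) * X) = Φ (A ^ p) := by
  have hP (i : Fin n) : 0 ≤ Φ (vecMulVec (fun r => hA.isHermitian.eigenvectorUnitary.1 r i)
      (star fun r => hA.isHermitian.eigenvectorUnitary.1 r i)) :=
    map_nonneg Φ (nonneg_iff_posSemidef.mpr (posSemidef_vecMulVec_self_star _))
  choose X hX using fun i => CStarAlgebra.nonneg_iff_eq_star_mul_self.mp (hP i)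
  refine ⟨fun i => hA.isHermitian.eigenvalues i.1, of fun i => X i.1 i.2,
    fun i => hA.eigenvalues_nonneg i.1, fun p hp => ?_⟩
  rw [rpow_eq_sum_vecMulVec hA, map_sum]
  ext r s
  rw [mul_apply, Fintype.sum_prod_type]
  simp only [conjTranspose_apply, diagonal_mul, of_apply]
  simp only [map_smul, hX, Matrix.sum_apply, Matrix.smul_apply, mul_apply, star_apply,
    smul_eq_mul, Finset.mul_sum]
  refine Finset.sum_congr rfl fun i _ => Finset.sum_congr rfl fun j _ => ?_
  have h : hA.isHermitian.eigenvalues i ^ p =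
      hA.isHermitian.eigenvalues i ^ (p / 2) * hA.isHermitian.eigenvalues i ^ (p / 2) := by
    rw [← Real.rpow_add_of_nonneg (hA.eigenvalues_nonneg i) (by positivity) (by positivity),
      add_halves]
  rw [h]
  simp only [star_mul', Complex.star_def, Complex.conj_ofReal]
  push_cast
  ring

/-! ### Products of singular values and determinants -/

theorem Matrix.PosSemidef.rpow_two_mul_rpow_half {n : Type*} [Fintype n] [DecidableEq n]
    {A : Matrix n n ℂ} (hA : A.PosSemidef) {p : ℝ} (hp : 0 ≤ p) :
    (A ^ (2 * p)) ^ (1 / 2 : ℝ) = A ^ p := by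
  have h0 := nonneg_iff_posSemidef.mpr hA
  rw [CFC.rpow_rpow_of_exponent_nonneg A _ _ (by positivity) (by positivity) h0]
  congr 1
  ring

theorem det_rpow {n : ℕ} {A : Matrix (Fin n) (Fin n) ℂ} (hA : A.PosSemidef) (p : ℝ) :
    (A ^ p).det = (((∏ i, hA.isHermitian.eigenvalues i) ^ p : ℝ) : ℂ) := by
  rw [CFC.rpow_eq_cfc_real (nonneg_iff_posSemidef.mpr hA), hA.isHermitian.cfc_eq,
    IsHermitian.cfc, Unitary.conjStarAlgAut_apply, det_mul_right_comm, ← Unitary.coe_star,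
    Unitary.coe_mul_star_self, one_mul, det_diagonal,
    ← Real.finsetProd_rpow _ _ fun i _ => hA.eigenvalues_nonneg i]
  simp

theorem prod_sing_eq_norm_det {n : ℕ} (N : Matrix (Fin n) (Fin n) ℂ) :
    ∏ i, sing N i = ‖N.det‖ := by
  rw [← sq_eq_sq₀ (Finset.prod_nonneg fun _ _ => sing_nonneg N _) (norm_nonneg _),
    ← Complex.ofReal_inj, ofReal_norm_det_sq, ← Finset.prod_pow]
  simp only [sing_sq]
  obtain ⟨Q, hQ1, hQ2, hQX⟩ :=
    exists_unitary_eq_diagonal_eigs (posSemidef_conjTranspose_mul_self N)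
  conv_rhs => rw [hQX]
  rw [det_mul_right_comm, hQ2, Matrix.one_mul, det_diagonal]
  push_cast
  rfl

theorem prod_rpow_mul_rpow {ι : Type*} (s : Finset ι) {a b : ι → ℝ} (ha : ∀ i, 0 ≤ a i)
    (hb : ∀ i, 0 ≤ b i) (α : ℝ) :
    ∏ i ∈ s, a i ^ (1 - α) * b i ^ α = (∏ i ∈ s, a i) ^ (1 - α) * (∏ i ∈ s, b i) ^ α := by
  rw [Finset.prod_mul_distrib, Real.finsetProd_rpow _ _ fun i _ => ha i,
    Real.finsetProd_rpow _ _ fun i _ => hb i]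

/-- With `N = Φ(A^p)^{1/2} Ψ(B^p)^{1/2}`, the matrix `sandwich Φ Ψ A B p` is `N Nᴴ`, which has the
same characteristic polynomial as `Nᴴ N`. -/
theorem eigs_sandwich {n m l : ℕ}
    (Φ : Matrix (Fin n) (Fin n) ℂ →ₚ[ℂ] Matrix (Fin l) (Fin l) ℂ)
    (Ψ : Matrix (Fin m) (Fin m) ℂ →ₚ[ℂ] Matrix (Fin l) (Fin l) ℂ)
    (A : Matrix (Fin n) (Fin n) ℂ) (B : Matrix (Fin m) (Fin m) ℂ) (p : ℝ) (i : Fin l) :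
    eigs (sandwich Φ Ψ A B p) (sandwich_posSemidef Φ Ψ A B p) i =
      sing (Φ (A ^ p) ^ (1 / 2 : ℝ) * Ψ (B ^ p) ^ (1 / 2 : ℝ)) i ^ 2 := by
  rw [sing_sq]
  refine congrFun (eigs_congr _ _ ?_) i
  rw [charpoly_mul_comm]
  congr 1
  have hY : (Ψ (B ^ p)).PosSemidef :=
    nonneg_iff_posSemidef.mp (map_nonneg Ψ CFC.rpow_nonneg)
  rw [sandwich, conjTranspose_mul, conjTranspose_rpow, conjTranspose_rpow]
  conv_lhs => rw [← hY.rpow_half_mul_self]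
  simp only [Matrix.mul_assoc]

/-! ### Log-majorization -/

/-- The singular value form of the majorization. For `p = (1 - α) p₀ + α p₁ > 0`, the product of
the `k` largest singular values of `Φ(A^p)^{1/2} Ψ(B^p)^{1/2}` is the maximum over contractions
`U`, `V` of `|det (Uᴴ x^{p/2} X Yᴴ y^{p/2} V)|`, where `Φ(A^p) = Xᴴ x^p X` and
`Ψ(B^p) = Yᴴ y^p Y`, so that `norm_det_interpolation` applies. -/
theorem weakLogMaj_sing {n m l : ℕ} {p₀ p₁ α : ℝ} (hp₀ : 0 ≤ p₀) (hp₁ : 0 ≤ p₁) (hα₀ : 0 ≤ α)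
    (hα₁ : α ≤ 1)
    (Φ : Matrix (Fin n) (Fin n) ℂ →ₚ[ℂ] Matrix (Fin l) (Fin l) ℂ)
    (Ψ : Matrix (Fin m) (Fin m) ℂ →ₚ[ℂ] Matrix (Fin l) (Fin l) ℂ)
    {A : Matrix (Fin n) (Fin n) ℂ} {B : Matrix (Fin m) (Fin m) ℂ} (hA : A.PosSemidef)
    (hB : B.PosSemidef) :
    WeakLogMaj
      (sing (Φ (A ^ ((1 - α) * p₀ + α * p₁)) ^ (1 / 2 : ℝ) *
        Ψ (B ^ ((1 - α) * p₀ + α * p₁)) ^ (1 / 2 : ℝ)))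
      (fun i => sing (Φ (A ^ p₀) ^ (1 / 2 : ℝ) * Ψ (B ^ p₀) ^ (1 / 2 : ℝ)) i ^ (1 - α) *
        sing (Φ (A ^ p₁) ^ (1 / 2 : ℝ) * Ψ (B ^ p₁) ^ (1 / 2 : ℝ)) i ^ α) := by
  rcases hα₀.eq_or_lt with rfl | hα₀'
  · intro k _ _
    simp
  rcases hα₁.eq_or_lt with rfl | hα₁'
  · intro k _ _
    simp
  intro k hk1 hk
  have hα' := sub_pos.mpr hα₁'
  -- With the endpoints gone, `p = 0` forces `p₀ = p₁ = 0`. This case is apart because `entirePow`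
  -- differs from `0 ^ 0 = 1` at the exponent `0`.
  rcases (add_nonneg (mul_nonneg hα'.le hp₀) (mul_nonneg hα₀ hp₁)).eq_or_lt' with hp | hp
  · have h := (add_eq_zero_iff_of_nonneg (mul_nonneg hα'.le hp₀) (mul_nonneg hα₀ hp₁)).mp hp
    obtain rfl : p₀ = 0 := (mul_eq_zero.mp h.1).resolve_left hα'.ne'
    obtain rfl : p₁ = 0 := (mul_eq_zero.mp h.2).resolve_left hα₀'.ne'
    refine (Finset.prod_congr rfl fun i _ => ?_).le
    beta_reduce
    rw [← Real.rpow_add_of_nonneg (sing_nonneg _ _) hα'.le hα₀, sub_add_cancel, Real.rpow_one, hp]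
  obtain ⟨x, X, hx, hX⟩ := exists_factor_map_rpow Φ hA
  obtain ⟨y, Y, hy, hY⟩ := exists_factor_map_rpow Ψ hB
  have hM (q : ℝ) :
      diagonal (fun i => ((x i ^ q : ℝ) : ℂ)) * X * (diagonal (fun i => ((y i ^ q : ℝ) : ℂ)) * Y)ᴴ =
      diagonal (fun i => ((x i ^ q : ℝ) : ℂ)) * (X * Yᴴ) *
        diagonal (fun i => ((y i ^ q : ℝ) : ℂ)) := by
    have : star (fun i => ((y i ^ q : ℝ) : ℂ)) = fun i => ((y i ^ q : ℝ) : ℂ) := by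
      ext i; simp
    rw [conjTranspose_mul, diagonal_conjTranspose, this]
    simp only [Matrix.mul_assoc]
  have hle (p : ℝ) (hp : 0 ≤ p) (U : Matrix (Fin n × Fin l) (Fin k) ℂ)
      (V : Matrix (Fin m × Fin l) (Fin k) ℂ) (hU : Uᴴ * U ≤ 1) (hV : Vᴴ * V ≤ 1) :=
    norm_det_le_prod_sing_of_factor hk hk1 (diagonal (fun i => ((x i ^ (p / 2) : ℝ) : ℂ)) * X)
      (diagonal (fun i => ((y i ^ (p / 2) : ℝ) : ℂ)) * Y) hU hV
  obtain ⟨U, V, hU, hV, hUV⟩ := exists_norm_det_eq_prod_sing_of_factor hk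
    (diagonal (fun i => ((x i ^ (((1 - α) * p₀ + α * p₁) / 2) : ℝ) : ℂ)) * X)
    (diagonal (fun i => ((y i ^ (((1 - α) * p₀ + α * p₁) / 2) : ℝ) : ℂ)) * Y)
  rw [hX _ hp.le, hY _ hp.le, hM] at hUV
  have hhalf : ((1 - α) * p₀ + α * p₁) / 2 = (1 - α) * (p₀ / 2) + α * (p₁ / 2) := by ring
  rw [prod_rpow_mul_rpow _ (sing_nonneg _) (sing_nonneg _)]
  simp only [prod_filter_lt_eq hk]
  rw [← hUV, hhalf]
  refine norm_det_interpolation (X * Yᴴ) hx hy hα₀ hα₁ ?_ ?_ ?_ hU hV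
  · rw [← hhalf]; positivity
  · intro U V hU hV
    have := hle p₀ hp₀ U V hU hV
    rwa [hX _ hp₀, hY _ hp₀, hM] at this
  · intro U V hU hV
    have := hle p₁ hp₁ U V hU hV
    rwa [hX _ hp₁, hY _ hp₁, hM] at this

theorem WeakLogMaj.sq_interpolation {n : ℕ} {a b c : Fin n → ℝ} {α : ℝ}
    (h : WeakLogMaj c fun i => a i ^ (1 - α) * b i ^ α) (ha : ∀ i, 0 ≤ a i) (hb : ∀ i, 0 ≤ b i)
    (hc : ∀ i, 0 ≤ c i) :
    WeakLogMaj (fun i => c i ^ 2) fun i => (a i ^ 2) ^ (1 - α) * (b i ^ 2) ^ α := by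
  intro k hk1 hk
  have e : ∀ i, (a i ^ 2) ^ (1 - α) * (b i ^ 2) ^ α = (a i ^ (1 - α) * b i ^ α) ^ 2 := fun i => by
    rw [mul_pow, Real.rpow_pow_comm (ha i), Real.rpow_pow_comm (hb i)]
  simp only [e, Finset.prod_pow]
  exact pow_le_pow_left₀ (Finset.prod_nonneg fun i _ => hc i) (h k hk1 hk) 2

theorem theorem3p1 (p₀ p₁ α pα : ℝ) (hp₀ : 0 ≤ p₀) (hp₁ : 0 ≤ p₁) (hα₀ : 0 ≤ α) (hα₁ : α ≤ 1)
    (hpα : pα = (1 - α) * p₀ + α * p₁) :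
    (∀ (n m l : ℕ)
      (Φ : Matrix (Fin n) (Fin n) ℂ →ₚ[ℂ] Matrix (Fin l) (Fin l) ℂ)
      (Ψ : Matrix (Fin m) (Fin m) ℂ →ₚ[ℂ] Matrix (Fin l) (Fin l) ℂ)
      (A : Matrix (Fin n) (Fin n) ℂ) (B : Matrix (Fin m) (Fin m) ℂ),
      A.PosSemidef → B.PosSemidef →
        WeakLogMaj
          (eigs (sandwich Φ Ψ A B pα) (sandwich_posSemidef Φ Ψ A B pα))
          (fun i =>
            eigs (sandwich Φ Ψ A B p₀) (sandwich_posSemidef Φ Ψ A B p₀) i ^ (1 - α) *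
            eigs (sandwich Φ Ψ A B p₁) (sandwich_posSemidef Φ Ψ A B p₁) i ^ α) ∧
        WeakLogMaj
          (sing (Φ (A ^ pα) ^ (1 / 2 : ℝ) * Ψ (B ^ pα) ^ (1 / 2 : ℝ)))
          (fun i =>
            sing (Φ (A ^ p₀) ^ (1 / 2 : ℝ) * Ψ (B ^ p₀) ^ (1 / 2 : ℝ)) i ^ (1 - α) *
            sing (Φ (A ^ p₁) ^ (1 / 2 : ℝ) * Ψ (B ^ p₁) ^ (1 / 2 : ℝ)) i ^ α)) ∧
    (∀ (n : ℕ) (A B : Matrix (Fin n) (Fin n) ℂ), A.PosSemidef → B.PosSemidef →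
      LogMaj
        (sing (A ^ pα * B ^ pα))
        (fun i => sing (A ^ p₀ * B ^ p₀) i ^ (1 - α) * sing (A ^ p₁ * B ^ p₁) i ^ α)) := by
  have hα' := sub_nonneg.mpr hα₁
  subst hpα
  refine ⟨fun n m l Φ Ψ A B hA hB => ?_, fun n A B hA hB => ⟨?_, ?_⟩⟩
  · have h := weakLogMaj_sing hp₀ hp₁ hα₀ hα₁ Φ Ψ hA hB
    refine ⟨?_, h⟩
    rw [funext (eigs_sandwich Φ Ψ A B ((1 - α) * p₀ + α * p₁))]
    simp only [eigs_sandwich]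
    exact h.sq_interpolation (sing_nonneg _) (sing_nonneg _) (sing_nonneg _)
  -- With `Φ = Ψ = id` and doubled exponents, `Φ(A^{2p})^{1/2} = A^p`.
  · have h := weakLogMaj_sing (mul_nonneg zero_le_two hp₀) (mul_nonneg zero_le_two hp₁) hα₀ hα₁
      (PositiveLinearMap.id ℂ _) (PositiveLinearMap.id ℂ _) hA hB
    have he : (1 - α) * (2 * p₀) + α * (2 * p₁) = 2 * ((1 - α) * p₀ + α * p₁) := by ring
    simp only [he, PositiveLinearMap.id_apply] at h
    rwa [hA.rpow_two_mul_rpow_half (by positivity), hB.rpow_two_mul_rpow_half (by positivity),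
      hA.rpow_two_mul_rpow_half hp₀, hB.rpow_two_mul_rpow_half hp₀,
      hA.rpow_two_mul_rpow_half hp₁, hB.rpow_two_mul_rpow_half hp₁] at h
  · rw [prod_rpow_mul_rpow _ (sing_nonneg _) (sing_nonneg _)]
    have ha := Finset.prod_nonneg fun i (_ : i ∈ Finset.univ) => hA.eigenvalues_nonneg i
    have hb := Finset.prod_nonneg fun i (_ : i ∈ Finset.univ) => hB.eigenvalues_nonneg i
    simp only [prod_sing_eq_norm_det, det_mul, det_rpow hA, det_rpow hB, ← Complex.ofReal_mul,
      Complex.norm_real, Real.norm_eq_abs]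
    set a := ∏ i, hA.isHermitian.eigenvalues i
    set b := ∏ i, hB.isHermitian.eigenvalues i
    rw [← Real.mul_rpow ha hb, ← Real.mul_rpow ha hb, ← Real.mul_rpow ha hb]
    have hab := mul_nonneg ha hb
    rw [abs_of_nonneg (Real.rpow_nonneg hab _), abs_of_nonneg (Real.rpow_nonneg hab _),
      abs_of_nonneg (Real.rpow_nonneg hab _), ← Real.rpow_mul hab, ← Real.rpow_mul hab,
      ← Real.rpow_add_of_nonneg hab (by positivity) (by positivity)]
    congr 1
    ring
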